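/- Let $p>0$, and let $d=(d_{ij})$ be a real $2\times 2$ matrix that is positive definite, i.e. $x^{T}dx>0$ for all $x\in\mathbb{R}^2\setminus\{0\}$ ($d$ need not be symmetric). For $r\in\mathbb{R}$ let $H^{r}=H^{r}(\mathbb{R}^{2})$ be the real Sobolev space of order $r$, i.e. the space of real-valued tempered distributions $u$ whose Fourier transform $\widehat u$ is a function with $\|u\|_{r}^{2}=\int_{\mathbb{R}^{2}}(1+|\xi|^{2})^{r}|\widehat{u}(\xi)|^{2}\,d\xi<\infty$ (with $\widehat u(\xi)=\int u(x)e^{-ix\cdot\xi}\,dx$, and up to a fixed constant factor in the norm), and give $H^{r}\times H^{r}$ the norm $\|(u,v)\|=(\|u\|_{r}^{2}+\|v\|_{r}^{2})^{1/2}$. Let $(-\Delta)^{p/2}$ be the Fourier multiplier with symbol $|\xi|^{p}$. Let $s\in\mathbb{R}$; in particular, $s=k+1$ with an integer $k\ge 0$ is allowed. Consider the operator $$D\mathbf{u}=-(-\Delta)^{p/2}\,d\,\mathbf{u},\qquad \mathrm{dom}(D)=H^{s}\times H^{s},$$ as an unbounded operator in the space $H^{s-p}\times H^{s-p}$. Then: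 1. $D$ is the infinitesimal generator of a $C_{0}$-semigroup $\{\mathcal{K}_{t},t\ge 0\}$ of bounded operators on $H^{s-p}\times H^{s-p}$ (the domain of the generator being exactly $H^{s}\times H^{s}$), and $\widehat{\mathcal{K}_{t}\mathbf{u}}(\xi)=e^{-t|\xi|^{p}d}\,\widehat{\mathbf{u}}(\xi)$ for almost every $\xi$, for all $t\ge0$ and all $\mathbf u\in H^{s-p}\times H^{s-p}$. 2. There is a constant $M>0$ such that the operator norm satisfies $\|\mathcal{K}_{t}\|\le M$ for all $t\ge 0$. 3. If $d$ is of one of the three reduced forms $$\begin{pmatrix}\lambda_{+}&0\\0&\lambda_{-}\end{pmatrix}\ (\lambda_{+}\ge\lambda_{-}>0),\qquad \begin{pmatrix}\alpha&\beta\\0&\alpha\end{pmatrix}\ (\alpha\ge\beta>0),\qquad \begin{pmatrix}\nu&-\mu\\\mu&\nu\end{pmatrix}\ (\nu>0,\ \mu\neq 0),$$ then $\|\mathcal{K}_{t}\|\le 1$ for all $t\ge 0$, i.e. $\{\mathcal{K}_t\}$ is a contraction semigroup. -/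

import Mathlib

open MeasureTheory FourierTransform Filter Topology
open scoped SchwartzMap ENNReal ComplexConjugate Matrix

noncomputable section

/-- The plane `ℝ²` with its Euclidean norm. -/
abbrev Plane : Type := EuclideanSpace ℝ (Fin 2)

/-! ### Fourier transforms that are functions

Mathlib normalizes the Fourier transform as `𝓕 f ξ = ∫ f x * exp (-2πi x·ξ)`. The frequency variable
of the convention `∫ f x * exp (-i x·ξ)` is therefore `2π ξ`, and `|ξ|` is written `2π ‖ξ‖` below. -/

/-- The tempered distribution `u` has a Fourier transform that is given by the function `g`. -/
def IsFourierTransform (u : 𝓢'(Plane, ℂ)) (g : Plane → ℂ) : Prop :=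
  LocallyIntegrable g volume ∧
    ∀ φ : 𝓢(Plane, ℂ), Integrable (fun ξ => φ ξ * g ξ) volume ∧ 𝓕 u φ = ∫ ξ, φ ξ * g ξ

/-- The tempered distribution `u` is real-valued: it commutes with complex conjugation. -/
def IsRealDistribution (u : 𝓢'(Plane, ℂ)) : Prop :=
  ∀ φ ψ : 𝓢(Plane, ℂ), (∀ x, ψ x = conj (φ x)) → u ψ = conj (u φ)

/-- The weight `(1 + |ξ|²)^(s/2)` of the Sobolev space of order `s`. -/
def sobolevWeight (s : ℝ) (ξ : Plane) : ℝ := (1 + (2 * Real.pi * ‖ξ‖) ^ 2) ^ (s / 2)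

lemma sobolevWeight_pos (s : ℝ) (ξ : Plane) : 0 < sobolevWeight s ξ :=
  Real.rpow_pos_of_pos (by positivity) _

lemma sobolevWeight_continuous (s : ℝ) : Continuous (sobolevWeight s) := by
  unfold sobolevWeight
  refine Continuous.rpow_const (by fun_prop) fun ξ => Or.inl ?_
  positivity

lemma sobolevWeight_temperate (s : ℝ) :
    (fun ξ : Plane => (sobolevWeight s ξ : ℂ)).HasTemperateGrowth := by
  have h := Function.hasTemperateGrowth_one_add_norm_sq_rpow Plane (s / 2)
  have h2 : ((fun x : Plane => (1 + ‖x‖ ^ 2) ^ (s / 2)) ∘ fun ξ : Plane =>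
      (2 * Real.pi) • ξ).HasTemperateGrowth := h.comp (by fun_prop)
  have h3 : (fun ξ : Plane => (1 + ‖(2 * Real.pi) • ξ‖ ^ 2) ^ (s / 2)).HasTemperateGrowth := h2
  have h4 : (fun ξ : Plane => sobolevWeight s ξ) =
      fun ξ : Plane => (1 + ‖(2 * Real.pi) • ξ‖ ^ 2) ^ (s / 2) := by
    ext ξ
    rw [sobolevWeight, norm_smul, Real.norm_of_nonneg (by positivity)]
  rw [← h4] at h3
  fun_prop

lemma sobolevWeight_neg_mul (s : ℝ) (ξ : Plane) :
    sobolevWeight (-s) ξ * sobolevWeight s ξ = 1 := by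
  rw [sobolevWeight, sobolevWeight, ← Real.rpow_add (by positivity)]
  simp [neg_div]

lemma IsFourierTransform.ae_eq {u : 𝓢'(Plane, ℂ)} {g h : Plane → ℂ}
    (hg : IsFourierTransform u g) (hh : IsFourierTransform u h) : g =ᵐ[volume] h := by
  have key : ∀ᵐ ξ ∂(volume : Measure Plane), (g - h) ξ = 0 := by
    refine ae_eq_zero_of_integral_contDiff_smul_eq_zero (hg.1.sub hh.1) ?_
    intro f hf hc
    have hc' : HasCompactSupport (Complex.ofRealCLM ∘ f) := hc.comp_left rfl
    have hf' : ContDiff ℝ (⊤ : ℕ∞) (Complex.ofRealCLM ∘ f) := by fun_prop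
    have h1 := hg.2 (hc'.toSchwartzMap hf')
    have h2 := hh.2 (hc'.toSchwartzMap hf')
    have h3 := integral_sub h1.1 h2.1
    rw [← h1.2, ← h2.2, sub_self] at h3
    rw [← h3]
    refine integral_congr_ae (Eventually.of_forall fun ξ => ?_)
    simp [mul_sub]
  filter_upwards [key] with ξ hξ
  exact sub_eq_zero.mp hξ

lemma IsFourierTransform.congr {u : 𝓢'(Plane, ℂ)} {g h : Plane → ℂ}
    (hg : IsFourierTransform u g) (e : g =ᵐ[volume] h) : IsFourierTransform u h := by
  refine ⟨?_, fun φ => ?_⟩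
  · exact hg.1.congr e
  · have e' : (fun ξ => φ ξ * g ξ) =ᵐ[volume] fun ξ => φ ξ * h ξ := by
      filter_upwards [e] with ξ hξ
      rw [hξ]
    exact ⟨(hg.2 φ).1.congr e', (hg.2 φ).2.trans (integral_congr_ae e')⟩

lemma IsFourierTransform.eq {u v : 𝓢'(Plane, ℂ)} {g : Plane → ℂ}
    (hu : IsFourierTransform u g) (hv : IsFourierTransform v g) : u = v := by
  have h : 𝓕 u = 𝓕 v := by
    ext φ
    rw [(hu.2 φ).2, (hv.2 φ).2]
  have h2 : (𝓕⁻ (𝓕 u) : 𝓢'(Plane, ℂ)) = 𝓕⁻ (𝓕 v) := by rw [h]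
  simpa using h2

lemma IsFourierTransform.add {u v : 𝓢'(Plane, ℂ)} {g h : Plane → ℂ}
    (hu : IsFourierTransform u g) (hv : IsFourierTransform v h) :
    IsFourierTransform (u + v) (g + h) := by
  refine ⟨hu.1.add hv.1, fun φ => ?_⟩
  have e : (fun ξ => φ ξ * (g + h) ξ) = (fun ξ => φ ξ * g ξ) + fun ξ => φ ξ * h ξ := by
    ext ξ
    simp [mul_add]
  rw [e]
  refine ⟨(hu.2 φ).1.add (hv.2 φ).1, ?_⟩
  rw [integral_add' (hu.2 φ).1 (hv.2 φ).1, ← (hu.2 φ).2, ← (hv.2 φ).2]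
  rfl

lemma IsFourierTransform.smul {u : 𝓢'(Plane, ℂ)} {g : Plane → ℂ} (c : ℝ)
    (hu : IsFourierTransform u g) : IsFourierTransform (c • u) (c • g) := by
  refine ⟨hu.1.smul c, fun φ => ?_⟩
  have e : (fun ξ => φ ξ * (c • g) ξ) = c • fun ξ => φ ξ * g ξ := by
    ext ξ
    simp only [Pi.smul_apply, Complex.real_smul]
    ring
  rw [e]
  refine ⟨(hu.2 φ).1.smul c, ?_⟩
  change _ = ∫ ξ, c • (φ ξ * g ξ)
  rw [integral_smul, ← (hu.2 φ).2]
  rfl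

lemma isFourierTransform_zero : IsFourierTransform 0 0 := by
  refine ⟨locallyIntegrable_zero, fun φ => ?_⟩
  simp only [Pi.zero_apply, mul_zero, integral_zero]
  exact ⟨integrable_zero _ _ _, rfl⟩

/-- Every function in a weighted `L²` space is a Fourier transform. -/
lemma exists_isFourierTransform {s : ℝ} {g : Plane → ℂ}
    (hg : MemLp (fun ξ => (sobolevWeight s ξ : ℂ) * g ξ) 2 volume) :
    ∃ u, IsFourierTransform u g := by
  have hgeq : ∀ ξ, g ξ = (sobolevWeight (-s) ξ : ℂ) * ((sobolevWeight s ξ : ℂ) * g ξ) := by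
    intro ξ
    rw [← mul_assoc, ← Complex.ofReal_mul, sobolevWeight_neg_mul]
    simp
  have hloc : LocallyIntegrable g volume := by
    have h1 := hg.locallyIntegrable (by norm_num)
    have hc : Continuous fun ξ : Plane => (sobolevWeight (-s) ξ : ℂ) :=
      Complex.continuous_ofReal.comp (sobolevWeight_continuous _)
    have h2 : LocallyIntegrable (fun ξ => (sobolevWeight (-s) ξ : ℂ) •
        ((sobolevWeight s ξ : ℂ) * g ξ)) volume := h1.continuous_smul hc
    refine h2.congr (Eventually.of_forall fun ξ => ?_)
    exact (hgeq ξ).symm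
  set f : Lp ℂ 2 (volume : Measure Plane) := hg.toLp _ with hf
  have hfe : f =ᵐ[volume] fun ξ => (sobolevWeight s ξ : ℂ) * g ξ := hg.coeFn_toLp
  refine ⟨𝓕⁻ (TemperedDistribution.smulLeftCLM ℂ
    (fun ξ : Plane => (sobolevWeight (-s) ξ : ℂ)) (f : 𝓢'(Plane, ℂ))), hloc, fun φ => ⟨?_, ?_⟩⟩
  · set χ := SchwartzMap.smulLeftCLM ℂ (fun ξ : Plane => (sobolevWeight (-s) ξ : ℂ)) φ with hχ
    have h1 : Integrable (fun ξ => χ ξ * ((sobolevWeight s ξ : ℂ) * g ξ)) volume :=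
      MemLp.integrable_mul (p := 2) (q := 2) (χ.memLp 2 volume) hg
    refine h1.congr (Eventually.of_forall fun ξ => ?_)
    simp only [hχ, SchwartzMap.smulLeftCLM_apply_apply (sobolevWeight_temperate (-s)), smul_eq_mul]
    conv_rhs => rw [hgeq ξ]
    ring
  · rw [fourier_fourierInv_eq, TemperedDistribution.smulLeftCLM_apply_apply,
      Lp.toTemperedDistribution_apply]
    refine integral_congr_ae ?_
    filter_upwards [hfe] with ξ hξ
    rw [hξ, SchwartzMap.smulLeftCLM_apply_apply (sobolevWeight_temperate (-s))]
    simp only [smul_eq_mul]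
    conv_rhs => rw [hgeq ξ]
    ring

/-! ### Real-valued distributions -/

lemma schwartz_exists_neg (φ : 𝓢(Plane, ℂ)) : ∃ ψ : 𝓢(Plane, ℂ), ∀ x, ψ x = φ (-x) :=
  ⟨SchwartzMap.compCLMOfContinuousLinearEquiv ℂ (ContinuousLinearEquiv.neg ℝ) φ, fun _ => rfl⟩

lemma integral_comp_neg_plane (f : Plane → ℂ) : ∫ ξ, f (-ξ) = ∫ ξ, f ξ :=
  integral_neg_eq_self f volume

/-- Complex conjugation becomes conjugation and reflection under the Fourier transform. -/
lemma fourier_conj_neg {φ ψ : 𝓢(Plane, ℂ)} (h : ∀ x, ψ x = conj (φ (-x))) (ξ : Plane) :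
    (𝓕 ψ) ξ = conj ((𝓕 φ) ξ) := by
  rw [SchwartzMap.fourier_coe, SchwartzMap.fourier_coe, Real.fourier_eq, Real.fourier_eq,
    ← integral_conj, ← integral_comp_neg_plane]
  refine integral_congr_ae (Eventually.of_forall fun x => ?_)
  simp only [h, neg_neg, inner_neg_left, Circle.smul_def, smul_eq_mul, map_mul]
  congr 1
  rw [Real.fourierChar_apply, Real.fourierChar_apply, ← Complex.exp_conj]
  congr 1
  simp [Complex.conj_ofNat]

lemma fourierInv_conj_neg {φ ψ : 𝓢(Plane, ℂ)} (h : ∀ x, ψ x = conj (φ x)) (ξ : Plane) :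
    (𝓕⁻ ψ) ξ = conj ((𝓕⁻ φ) (-ξ)) := by
  rw [SchwartzMap.fourierInv_coe, SchwartzMap.fourierInv_coe, Real.fourierInv_eq,
    Real.fourierInv_eq, ← integral_conj]
  refine integral_congr_ae (Eventually.of_forall fun x => ?_)
  simp only [h, inner_neg_right, Circle.smul_def, smul_eq_mul, map_mul]
  congr 1
  rw [Real.fourierChar_apply, Real.fourierChar_apply, ← Complex.exp_conj]
  congr 1
  simp [Complex.conj_ofNat]

/-- The Fourier transform of a real-valued distribution is Hermitian. -/
lemma IsFourierTransform.hermitian {u : 𝓢'(Plane, ℂ)} {g : Plane → ℂ}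
    (hg : IsFourierTransform u g) (hu : IsRealDistribution u) :
    (fun ξ => conj (g (-ξ))) =ᵐ[volume] g := by
  have hloc : LocallyIntegrable (fun ξ => conj (g (-ξ))) volume := by
    have h1 : LocallyIntegrable (fun ξ => g (-ξ)) volume := by
      have h2 : Measure.map (Homeomorph.neg Plane) (volume : Measure Plane) = volume :=
        (Measure.measurePreserving_neg (volume : Measure Plane)).map_eq
      have h3 : LocallyIntegrable g (Measure.map (Homeomorph.neg Plane) volume) := by
        rw [h2]
        exact hg.1
      exact (locallyIntegrable_map_homeomorph (Homeomorph.neg Plane)).mp h3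
    intro x
    obtain ⟨s, hs, hi⟩ := h1 x
    exact ⟨s, hs, (Complex.conjCLE : ℂ →L[ℝ] ℂ).integrable_comp hi⟩
  have key : ∀ᵐ ξ ∂(volume : Measure Plane), ((fun ξ => conj (g (-ξ))) - g) ξ = 0 := by
    refine ae_eq_zero_of_integral_contDiff_smul_eq_zero (hloc.sub hg.1) ?_
    intro f hf hc
    have hc' : HasCompactSupport (Complex.ofRealCLM ∘ f) := hc.comp_left rfl
    have hf' : ContDiff ℝ (⊤ : ℕ∞) (Complex.ofRealCLM ∘ f) := by fun_prop
    set φ : 𝓢(Plane, ℂ) := hc'.toSchwartzMap hf' with hφ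
    have hφv : ∀ x, φ x = (f x : ℂ) := fun x => rfl
    obtain ⟨ψ, hψ⟩ := schwartz_exists_neg φ
    have h1 := hg.2 φ
    have h2 := hg.2 ψ
    have h3 : 𝓕 u ψ = conj (𝓕 u φ) := by
      rw [TemperedDistribution.fourier_apply, TemperedDistribution.fourier_apply]
      refine hu _ _ fun ξ => fourier_conj_neg (fun x => ?_) ξ
      rw [hψ, hφv, Complex.conj_ofReal]
    have e : ∀ ξ, (f ξ : ℂ) * conj (g (-ξ)) = conj (ψ (-ξ) * g (-ξ)) := by
      intro ξ
      rw [hψ, neg_neg, hφv, map_mul, Complex.conj_ofReal]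
    have h4 : ∫ ξ, (f ξ : ℂ) * conj (g (-ξ)) = ∫ ξ, φ ξ * g ξ := by
      simp_rw [e]
      rw [integral_conj, integral_comp_neg_plane (fun ξ => ψ ξ * g ξ), ← h2.2, h3,
        Complex.conj_conj, h1.2]
    have h5 : Integrable (fun ξ => (f ξ : ℂ) * conj (g (-ξ))) volume := by
      simp_rw [e]
      exact (Complex.conjCLE : ℂ →L[ℝ] ℂ).integrable_comp h2.1.comp_neg
    have h6 := integral_sub h5 h1.1
    rw [h4, sub_self] at h6
    rw [← h6]
    refine integral_congr_ae (Eventually.of_forall fun ξ => ?_)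
    simp [mul_sub, hφv]
  filter_upwards [key] with ξ hξ
  exact sub_eq_zero.mp hξ

/-- A distribution with Hermitian Fourier transform is real-valued. -/
lemma IsFourierTransform.isReal {u : 𝓢'(Plane, ℂ)} {g : Plane → ℂ}
    (hg : IsFourierTransform u g) (h : (fun ξ => conj (g (-ξ))) =ᵐ[volume] g) :
    IsRealDistribution u := by
  intro φ ψ hφψ
  have e : ∀ χ : 𝓢(Plane, ℂ), u χ = 𝓕 u (𝓕⁻ χ) := by
    intro χ
    rw [TemperedDistribution.fourier_apply, fourier_fourierInv_eq]
  rw [e, e, (hg.2 _).2, (hg.2 _).2, ← integral_conj,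
    ← integral_comp_neg_plane fun ξ => conj ((𝓕⁻ φ : 𝓢(Plane, ℂ)) ξ * g ξ)]
  refine integral_congr_ae ?_
  filter_upwards [h] with ξ hξ
  rw [fourierInv_conj_neg hφψ, map_mul, hξ]

/-! ### Sobolev spaces -/

/-- The real vector space of real-valued tempered distributions `u` on the plane whose Fourier
transform is a function with `∫ (1 + |ξ|²)^s |û(ξ)|² < ∞`. -/
def sobolevSubmodule (s : ℝ) : Submodule ℝ 𝓢'(Plane, ℂ) where
  carrier := {u | IsRealDistribution u ∧ ∃ g, IsFourierTransform u g ∧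
    MemLp (fun ξ => (sobolevWeight s ξ : ℂ) * g ξ) 2 volume}
  zero_mem' := by
    refine ⟨fun φ ψ _ => ?_, 0, isFourierTransform_zero, ?_⟩
    · simp
    · simp
  add_mem' := by
    rintro u v ⟨hu, g, hg, hg2⟩ ⟨hv, h, hh, hh2⟩
    refine ⟨fun φ ψ e => ?_, g + h, hg.add hh, ?_⟩
    · have h1 := hu φ ψ e
      have h2 := hv φ ψ e
      change u ψ + v ψ = conj (u φ + v φ)
      rw [h1, h2, map_add]
    · refine (hg2.add hh2).ae_eq (Eventually.of_forall fun ξ => ?_)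
      simp [mul_add]
  smul_mem' := by
    rintro c u ⟨hu, g, hg, hg2⟩
    refine ⟨fun φ ψ e => ?_, c • g, hg.smul c, ?_⟩
    · have h1 := hu φ ψ e
      change c • u ψ = conj (c • u φ)
      rw [h1]
      simp
    · refine (hg2.const_smul c).ae_eq (Eventually.of_forall fun ξ => ?_)
      simp only [Pi.smul_apply, Complex.real_smul]
      ring

/-- The real Sobolev space `H^s = H^s(ℝ²)` of order `s ∈ ℝ`. -/
def Sobolev (s : ℝ) : Type := sobolevSubmodule s

namespace Sobolev

variable {s : ℝ}

instance : AddCommGroup (Sobolev s) := inferInstanceAs (AddCommGroup (sobolevSubmodule s))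

instance : Module ℝ (Sobolev s) := inferInstanceAs (Module ℝ (sobolevSubmodule s))

/-- The tempered distribution that underlies an element of `H^s`. -/
def toDistribution : Sobolev s →ₗ[ℝ] 𝓢'(Plane, ℂ) := (sobolevSubmodule s).subtype

lemma toDistribution_injective :
    Function.Injective (toDistribution : Sobolev s →ₗ[ℝ] 𝓢'(Plane, ℂ)) :=
  Subtype.val_injective

lemma toDistribution_mem (u : Sobolev s) : toDistribution u ∈ sobolevSubmodule s := Subtype.prop u

/-- The Fourier transform `û` of `u ∈ H^s`, a function that is determined almost everywhere. -/
def fourier (u : Sobolev s) : Plane → ℂ := (toDistribution_mem u).2.choose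

lemma isFourierTransform (u : Sobolev s) : IsFourierTransform (toDistribution u) (fourier u) :=
  (toDistribution_mem u).2.choose_spec.1

lemma memLp (u : Sobolev s) :
    MemLp (fun ξ => (sobolevWeight s ξ : ℂ) * fourier u ξ) 2 volume :=
  (toDistribution_mem u).2.choose_spec.2

lemma fourier_add (u v : Sobolev s) : fourier (u + v) =ᵐ[volume] fourier u + fourier v := by
  refine (isFourierTransform (u + v)).ae_eq ?_
  rw [map_add]
  exact (isFourierTransform u).add (isFourierTransform v)

lemma fourier_smul (c : ℝ) (u : Sobolev s) : fourier (c • u) =ᵐ[volume] c • fourier u := by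
  refine (isFourierTransform (c • u)).ae_eq ?_
  rw [map_smul]
  exact (isFourierTransform u).smul c

/-- The map `u ↦ (1 + |ξ|²)^(s/2) û(ξ)` from `H^s` to `L²`. -/
def weightedFourier : Sobolev s →ₗ[ℝ] Lp ℂ 2 (volume : Measure Plane) where
  toFun u := (memLp u).toLp _
  map_add' u v := by
    rw [← MemLp.toLp_add, MemLp.toLp_eq_toLp_iff]
    filter_upwards [fourier_add u v] with ξ hξ
    simp [hξ, mul_add]
  map_smul' c u := by
    rw [RingHom.id_apply, ← MemLp.toLp_const_smul, MemLp.toLp_eq_toLp_iff]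
    filter_upwards [fourier_smul c u] with ξ hξ
    simp only [hξ, Pi.smul_apply, Complex.real_smul]
    ring

lemma weightedFourier_injective :
    Function.Injective (weightedFourier : Sobolev s →ₗ[ℝ] Lp ℂ 2 (volume : Measure Plane)) := by
  intro u v h
  have h1 : (fun ξ => (sobolevWeight s ξ : ℂ) * fourier u ξ) =ᵐ[volume]
      fun ξ => (sobolevWeight s ξ : ℂ) * fourier v ξ :=
    (MemLp.toLp_eq_toLp_iff (memLp u) (memLp v)).mp h
  have h2 : fourier u =ᵐ[volume] fourier v := by
    filter_upwards [h1] with ξ hξ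
    exact mul_left_cancel₀ (Complex.ofReal_ne_zero.mpr (sobolevWeight_pos s ξ).ne') hξ
  exact toDistribution_injective
    (((isFourierTransform u).congr h2).eq (isFourierTransform v))

/-- The norm of `H^s` is `‖u‖_s = (∫ (1 + |ξ|²)^s |û(ξ)|²)^(1/2)`. -/
instance : NormedAddCommGroup (Sobolev s) :=
  NormedAddCommGroup.induced (Sobolev s) (Lp ℂ 2 (volume : Measure Plane)) weightedFourier
    weightedFourier_injective

instance : NormedSpace ℝ (Sobolev s) :=
  NormedSpace.induced ℝ (Sobolev s) (Lp ℂ 2 (volume : Measure Plane)) weightedFourier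

end Sobolev

/-! ### The fractional Laplacian -/

/-- The symbol `|ξ|^p` of `(-Δ)^(p/2)`. -/
def fracSymbol (p : ℝ) (ξ : Plane) : ℝ := (2 * Real.pi * ‖ξ‖) ^ p

lemma fracSymbol_nonneg (p : ℝ) (ξ : Plane) : 0 ≤ fracSymbol p ξ :=
  Real.rpow_nonneg (by positivity) _

lemma sobolevWeight_mul_fracSymbol_le {p : ℝ} (hp : 0 < p) (s : ℝ) (ξ : Plane) :
    sobolevWeight (s - p) ξ * fracSymbol p ξ ≤ sobolevWeight s ξ := by
  have h1 : fracSymbol p ξ ≤ sobolevWeight p ξ := by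
    have h0 : 0 ≤ 2 * Real.pi * ‖ξ‖ := by positivity
    rw [fracSymbol, sobolevWeight]
    calc (2 * Real.pi * ‖ξ‖) ^ p = ((2 * Real.pi * ‖ξ‖) ^ 2) ^ (p / 2) := by
          rw [← Real.rpow_natCast, ← Real.rpow_mul h0]
          congr 1
          push_cast
          ring
      _ ≤ _ := Real.rpow_le_rpow (by positivity) (by linarith) (by positivity)
  have h2 : sobolevWeight s ξ = sobolevWeight (s - p) ξ * sobolevWeight p ξ := by
    rw [sobolevWeight, sobolevWeight, sobolevWeight, ← Real.rpow_add (by positivity)]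
    congr 1
    ring
  rw [h2]
  exact mul_le_mul_of_nonneg_left h1 (sobolevWeight_pos _ _).le

lemma exists_fracLaplacian {p : ℝ} (hp : 0 < p) {s : ℝ} (u : Sobolev s) :
    ∃ v : Sobolev (s - p), v.fourier =ᵐ[volume] fun ξ => (fracSymbol p ξ : ℂ) * u.fourier ξ := by
  have hm : Continuous (fracSymbol p) := by
    unfold fracSymbol
    exact Continuous.rpow_const (by fun_prop) fun _ => Or.inr hp.le
  have hg := u.isFourierTransform
  have hL : MemLp (fun ξ => (sobolevWeight (s - p) ξ : ℂ) *
      ((fracSymbol p ξ : ℂ) * u.fourier ξ)) 2 volume := by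
    refine u.memLp.mono ?_ (Eventually.of_forall fun ξ => ?_)
    · have h1 := hg.1.aestronglyMeasurable
      have h2 : Continuous fun ξ => (fracSymbol p ξ : ℂ) := Complex.continuous_ofReal.comp hm
      have h3 : Continuous fun ξ => (sobolevWeight (s - p) ξ : ℂ) :=
        Complex.continuous_ofReal.comp (sobolevWeight_continuous _)
      exact h3.aestronglyMeasurable.mul (h2.aestronglyMeasurable.mul h1)
    · rw [← mul_assoc, ← Complex.ofReal_mul, norm_mul, norm_mul, Complex.norm_real,
        Complex.norm_real, Real.norm_of_nonneg (sobolevWeight_pos _ _).le, Real.norm_of_nonneg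
        (mul_nonneg (sobolevWeight_pos _ _).le (fracSymbol_nonneg _ _))]
      exact mul_le_mul_of_nonneg_right (sobolevWeight_mul_fracSymbol_le hp s ξ) (norm_nonneg _)
  obtain ⟨v, hv⟩ := exists_isFourierTransform hL
  have hr : IsRealDistribution v := by
    refine hv.isReal ?_
    filter_upwards [hg.hermitian u.toDistribution_mem.1] with ξ hξ
    simp only [map_mul, Complex.conj_ofReal, hξ]
    simp [fracSymbol]
  let w : Sobolev (s - p) := ⟨v, hr, _, hv, hL⟩
  exact ⟨w, w.isFourierTransform.ae_eq hv⟩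

/-- The fractional Laplacian `(-Δ)^(p/2) : H^s → H^(s-p)`, the Fourier multiplier with the
symbol `|ξ|^p`. -/
def fracLaplacian {p : ℝ} (hp : 0 < p) {s : ℝ} (u : Sobolev s) : Sobolev (s - p) :=
  (exists_fracLaplacian hp u).choose

lemma fourier_fracLaplacian {p : ℝ} (hp : 0 < p) {s : ℝ} (u : Sobolev s) :
    (fracLaplacian hp u).fourier =ᵐ[volume] fun ξ => (fracSymbol p ξ : ℂ) * u.fourier ξ :=
  (exists_fracLaplacian hp u).choose_spec

lemma Sobolev.eq_of_fourier {s : ℝ} {u v : Sobolev s} (h : u.fourier =ᵐ[volume] v.fourier) :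
    u = v :=
  Sobolev.toDistribution_injective ((u.isFourierTransform.congr h).eq v.isFourierTransform)

lemma fracLaplacian_add {p : ℝ} (hp : 0 < p) {s : ℝ} (u v : Sobolev s) :
    fracLaplacian hp (u + v) = fracLaplacian hp u + fracLaplacian hp v := by
  refine Sobolev.eq_of_fourier ?_
  filter_upwards [fourier_fracLaplacian hp (u + v), fourier_fracLaplacian hp u,
    fourier_fracLaplacian hp v, Sobolev.fourier_add u v,
    Sobolev.fourier_add (fracLaplacian hp u) (fracLaplacian hp v)] with ξ h1 h2 h3 h4 h5
  rw [h1, h4, h5, Pi.add_apply, Pi.add_apply, h2, h3, mul_add]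

lemma fracLaplacian_smul {p : ℝ} (hp : 0 < p) {s : ℝ} (c : ℝ) (u : Sobolev s) :
    fracLaplacian hp (c • u) = c • fracLaplacian hp u := by
  refine Sobolev.eq_of_fourier ?_
  filter_upwards [fourier_fracLaplacian hp (c • u), fourier_fracLaplacian hp u,
    Sobolev.fourier_smul c u, Sobolev.fourier_smul c (fracLaplacian hp u)] with ξ h1 h2 h3 h4
  rw [h1, h3, h4, Pi.smul_apply, Pi.smul_apply, h2, Complex.real_smul, Complex.real_smul]
  ring

/-! ### The cross-diffusion operator -/

/-- `H^s × H^s` with the norm `‖(u, v)‖ = (‖u‖² + ‖v‖²)^(1/2)`. -/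
abbrev SobolevPair (s : ℝ) : Type := WithLp 2 (Sobolev s × Sobolev s)

/-- The pairs in `H^r × H^r` whose two components lie in `H^s`. -/
def pairDomain (s r : ℝ) : Submodule ℝ (SobolevPair r) where
  carrier := {U | U.fst.toDistribution ∈ sobolevSubmodule s ∧
    U.snd.toDistribution ∈ sobolevSubmodule s}
  zero_mem' := by
    simp
  add_mem' := by
    rintro U V ⟨h1, h2⟩ ⟨h3, h4⟩
    refine ⟨?_, ?_⟩
    · simpa using Submodule.add_mem _ h1 h3
    · simpa using Submodule.add_mem _ h2 h4
  smul_mem' := by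
    rintro c U ⟨h1, h2⟩
    refine ⟨?_, ?_⟩
    · simpa using Submodule.smul_mem _ c h1
    · simpa using Submodule.smul_mem _ c h2

/-- The first component of a pair in `pairDomain s r`, as an element of `H^s`. -/
def pairFst {s r : ℝ} (U : pairDomain s r) : Sobolev s := ⟨U.1.fst.toDistribution, U.2.1⟩

/-- The second component of a pair in `pairDomain s r`, as an element of `H^s`. -/
def pairSnd {s r : ℝ} (U : pairDomain s r) : Sobolev s := ⟨U.1.snd.toDistribution, U.2.2⟩

lemma pairFst_add {s r : ℝ} (U V : pairDomain s r) : pairFst (U + V) = pairFst U + pairFst V :=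
  rfl

lemma pairSnd_add {s r : ℝ} (U V : pairDomain s r) : pairSnd (U + V) = pairSnd U + pairSnd V :=
  rfl

lemma pairFst_smul {s r : ℝ} (c : ℝ) (U : pairDomain s r) : pairFst (c • U) = c • pairFst U :=
  rfl

lemma pairSnd_smul {s r : ℝ} (c : ℝ) (U : pairDomain s r) : pairSnd (c • U) = c • pairSnd U :=
  rfl

/-- The operator `D = -(-Δ)^(p/2) d` with domain `H^s × H^s`, as an unbounded operator in
`H^(s-p) × H^(s-p)`; it maps `(u, v)` to
`-(d₁₁ (-Δ)^(p/2) u + d₁₂ (-Δ)^(p/2) v, d₂₁ (-Δ)^(p/2) u + d₂₂ (-Δ)^(p/2) v)`. -/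
def crossDiffusion {p : ℝ} (hp : 0 < p) (d : Matrix (Fin 2) (Fin 2) ℝ) (s : ℝ) :
    SobolevPair (s - p) →ₗ.[ℝ] SobolevPair (s - p) where
  domain := pairDomain s (s - p)
  toFun :=
    { toFun := fun U => WithLp.toLp 2
        (-(d 0 0 • fracLaplacian hp (pairFst U) + d 0 1 • fracLaplacian hp (pairSnd U)),
          -(d 1 0 • fracLaplacian hp (pairFst U) + d 1 1 • fracLaplacian hp (pairSnd U)))
      map_add' := by
        intro U V
        rw [← WithLp.toLp_add]
        congr 1
        simp only [pairFst_add, pairSnd_add, fracLaplacian_add, Prod.mk_add_mk]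
        ext1 <;> module
      map_smul' := by
        intro c U
        rw [RingHom.id_apply, ← WithLp.toLp_smul]
        congr 1
        simp only [pairFst_smul, pairSnd_smul, fracLaplacian_smul, Prod.smul_mk]
        ext1 <;> module }

/-! ### Semigroups -/

/-- `T t`, `t ≥ 0`, is a `C₀`-semigroup of bounded operators on `E`. Only the values at `t ≥ 0`
matter. -/
structure IsC0Semigroup {E : Type*} [NormedAddCommGroup E] [NormedSpace ℝ E]
    (T : ℝ → E →L[ℝ] E) : Prop where
  map_zero : T 0 = ContinuousLinearMap.id ℝ E
  map_add : ∀ t₁ t₂ : ℝ, 0 ≤ t₁ → 0 ≤ t₂ → T (t₁ + t₂) = (T t₁).comp (T t₂)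
  tendsto_zero : ∀ x : E, Tendsto (fun t => T t x) (𝓝[>] 0) (𝓝 x)

/-- `A` is the infinitesimal generator of `T`: `x` lies in the domain of `A` and `A x = y` if and
only if `(T h x - x) / h` converges to `y` as `h → 0⁺`. -/
def IsInfinitesimalGenerator {E : Type*} [NormedAddCommGroup E] [NormedSpace ℝ E]
    (A : E →ₗ.[ℝ] E) (T : ℝ → E →L[ℝ] E) : Prop :=
  ∀ x y : E, (x, y) ∈ A.graph ↔ Tendsto (fun h : ℝ => h⁻¹ • (T h x - x)) (𝓝[>] 0) (𝓝 y)

/-! ### The matrices -/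

/-- `d` is positive definite, without being assumed symmetric. -/
def IsPositiveDefinite (d : Matrix (Fin 2) (Fin 2) ℝ) : Prop :=
  ∀ x : Fin 2 → ℝ, x ≠ 0 → 0 < x ⬝ᵥ d *ᵥ x

/-- The three reduced forms of a positive definite matrix. -/
def IsReducedForm (d : Matrix (Fin 2) (Fin 2) ℝ) : Prop :=
  (∃ a b : ℝ, b ≤ a ∧ 0 < b ∧ d = !![a, 0; 0, b]) ∨
  (∃ α β : ℝ, β ≤ α ∧ 0 < β ∧ d = !![α, β; 0, α]) ∨
  (∃ ν μ : ℝ, 0 < ν ∧ μ ≠ 0 ∧ d = !![ν, -μ; μ, ν])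

/-- The symbol `e^{-t |ξ|^p d}`. -/
def crossDiffusionSymbol (p : ℝ) (d : Matrix (Fin 2) (Fin 2) ℝ) (t : ℝ) (ξ : Plane) :
    Matrix (Fin 2) (Fin 2) ℝ :=
  NormedSpace.exp (-(t * fracSymbol p ξ) • d)

/-- The Fourier transform of a pair. -/
def SobolevPair.fourier {s : ℝ} (U : SobolevPair s) (ξ : Plane) : Fin 2 → ℂ :=
  ![U.fst.fourier ξ, U.snd.fourier ξ]

end

noncomputable section

/-! ### The flow of a positive definite matrix -/

/-! On the Fourier side every operator here multiplies `Û(ξ) ∈ ℂ²` by a matrix, so the theorem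
reduces to the flow `e^{-τ d}` on `ℂ²` at time `τ = t |ξ|^p ≥ 0`. Since `d` is real with positive
quadratic form, the squared Hermitian norm of `e^{-τ d} z` is nonincreasing in `τ`
(`IsPositiveDefinite.hermitianSq_matrixFlow_le`). The Sobolev weight is scalar, so the pointwise
contraction integrates to `‖K t‖ ≤ 1` for every positive definite `d`; this one bound gives both
norm estimates. The symbol is real and even in `ξ`, so real-valued pairs stay real-valued. Strong
continuity follows by dominated convergence.

For the generator, the difference quotients converge pointwise to `-|ξ|^p d Û(ξ)`. If `U` lies in
`H^s × H^s`, they are dominated by a multiple of `|ξ|^p |Û|`, and the convergence holds in norm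
(`tendsto_zero_of_dominated`). Conversely, if they converge in norm to `V`, Fatou's lemma forces `V̂
= -|ξ|^p d Û` almost everywhere (`ae_eq_zero_of_tendsto_zero`). As `d` is invertible, `|ξ|^p |Û|` is
then bounded by a multiple of `|V̂|`, which gains the `p` derivatives that put `U` in `H^s × H^s`
(`mem_crossDiffusion_graph_iff`). Hence the domain is neither smaller nor larger. -/

/-- The square of the Hermitian norm on `ℂ²`. -/
def hermitianSq (z : Fin 2 → ℂ) : ℝ := ‖z 0‖ ^ 2 + ‖z 1‖ ^ 2

lemma hermitianSq_nonneg (z : Fin 2 → ℂ) : 0 ≤ hermitianSq z := by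
  unfold hermitianSq
  positivity

lemma hermitianSq_eq_zero {z : Fin 2 → ℂ} (h : hermitianSq z = 0) : z = 0 := by
  have h0 : ‖z 0‖ = 0 := by
    unfold hermitianSq at h
    nlinarith [sq_nonneg ‖z 0‖, sq_nonneg ‖z 1‖]
  have h1 : ‖z 1‖ = 0 := by
    unfold hermitianSq at h
    nlinarith [sq_nonneg ‖z 0‖, sq_nonneg ‖z 1‖]
  ext i
  fin_cases i
  · simpa using h0
  · simpa using h1

lemma hermitianSq_continuous : Continuous hermitianSq := by
  unfold hermitianSq
  fun_prop

lemma hermitianSq_smul (c : ℝ) (z : Fin 2 → ℂ) : hermitianSq (c • z) = c ^ 2 * hermitianSq z := by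
  simp only [hermitianSq, Pi.smul_apply, norm_smul, mul_pow, Real.norm_eq_abs, sq_abs]
  ring

lemma hermitianSq_add_le (z w : Fin 2 → ℂ) :
    hermitianSq (z + w) ≤ 2 * hermitianSq z + 2 * hermitianSq w := by
  have h : ∀ a b : ℂ, ‖a + b‖ ^ 2 ≤ 2 * ‖a‖ ^ 2 + 2 * ‖b‖ ^ 2 := fun a b => by
    have h1 := norm_add_le a b
    nlinarith [sq_nonneg (‖a‖ - ‖b‖), norm_nonneg (a + b)]
  have h0 := h (z 0) (w 0)
  have h1 := h (z 1) (w 1)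
  simp only [hermitianSq, Pi.add_apply]
  linarith

/-- `Fin 2 → ℂ` carries the sup norm. This comparison and the next one carry operator norm and mean
value estimates over to the Hermitian norm, the one in which the flow contracts. -/
lemma norm_sq_le_hermitianSq (z : Fin 2 → ℂ) : ‖z‖ ^ 2 ≤ hermitianSq z := by
  have h : ‖z‖ ≤ √(hermitianSq z) := by
    refine (pi_norm_le_iff_of_nonneg (Real.sqrt_nonneg _)).2 fun i => Real.le_sqrt_of_sq_le ?_
    fin_cases i <;> simp [hermitianSq]
  calc ‖z‖ ^ 2 ≤ √(hermitianSq z) ^ 2 := by gcongr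
    _ = _ := Real.sq_sqrt (hermitianSq_nonneg z)

lemma hermitianSq_le_norm_sq (z : Fin 2 → ℂ) : hermitianSq z ≤ 2 * ‖z‖ ^ 2 := by
  have h0 : ‖z 0‖ ^ 2 ≤ ‖z‖ ^ 2 := by gcongr; exact norm_le_pi_norm z 0
  have h1 : ‖z 1‖ ^ 2 ≤ ‖z‖ ^ 2 := by gcongr; exact norm_le_pi_norm z 1
  unfold hermitianSq
  linarith

/-- A real matrix acting on `ℂ²`. -/
def complexAction (d : Matrix (Fin 2) (Fin 2) ℝ) : (Fin 2 → ℂ) →L[ℝ] (Fin 2 → ℂ) :=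
  ((Matrix.mulVecLin (d.map Complex.ofReal)).restrictScalars ℝ).toContinuousLinearMap

lemma complexAction_apply (d : Matrix (Fin 2) (Fin 2) ℝ) (z : Fin 2 → ℂ) :
    complexAction d z = d.map Complex.ofReal *ᵥ z := rfl

lemma complexAction_zero_apply (d : Matrix (Fin 2) (Fin 2) ℝ) (z : Fin 2 → ℂ) :
    complexAction d z 0 = d 0 0 * z 0 + d 0 1 * z 1 := by
  simp [complexAction_apply, Matrix.mulVec, dotProduct, Fin.sum_univ_two]

lemma complexAction_one_apply (d : Matrix (Fin 2) (Fin 2) ℝ) (z : Fin 2 → ℂ) :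
    complexAction d z 1 = d 1 0 * z 0 + d 1 1 * z 1 := by
  simp [complexAction_apply, Matrix.mulVec, dotProduct, Fin.sum_univ_two]

lemma complexAction_one (z : Fin 2 → ℂ) : complexAction 1 z = z := by
  ext i
  fin_cases i
  · simp [complexAction_zero_apply]
  · simp [complexAction_one_apply]

lemma complexAction_mul (a b : Matrix (Fin 2) (Fin 2) ℝ) (z : Fin 2 → ℂ) :
    complexAction (a * b) z = complexAction a (complexAction b z) := by
  simp only [complexAction_apply, Matrix.mulVec_mulVec]
  congr 1
  exact Matrix.map_mul (f := Complex.ofRealHom)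

lemma exists_hermitianSq_complexAction_le (d : Matrix (Fin 2) (Fin 2) ℝ) :
    ∃ C, 0 < C ∧ ∀ z, hermitianSq (complexAction d z) ≤ C * hermitianSq z := by
  -- The summand `1` keeps the constant positive when `d = 0`.
  refine ⟨2 * ‖complexAction d‖ ^ 2 + 1, by positivity, fun z => ?_⟩
  calc hermitianSq (complexAction d z) ≤ 2 * ‖complexAction d z‖ ^ 2 := hermitianSq_le_norm_sq _
    _ ≤ 2 * (‖complexAction d‖ * ‖z‖) ^ 2 := by
        gcongr
        exact (complexAction d).le_opNorm z
    _ = 2 * ‖complexAction d‖ ^ 2 * ‖z‖ ^ 2 := by ring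
    _ ≤ 2 * ‖complexAction d‖ ^ 2 * hermitianSq z := by
        gcongr
        exact norm_sq_le_hermitianSq z
    _ ≤ _ := by nlinarith [hermitianSq_nonneg z]

lemma IsPositiveDefinite.nonneg {d : Matrix (Fin 2) (Fin 2) ℝ} (hd : IsPositiveDefinite d)
    (a b : ℝ) : 0 ≤ a * (d 0 0 * a + d 0 1 * b) + b * (d 1 0 * a + d 1 1 * b) := by
  by_cases h : (![a, b] : Fin 2 → ℝ) = 0
  · have h0 : a = 0 := by simpa using congrFun h 0
    have h1 : b = 0 := by simpa using congrFun h 1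
    simp [h0, h1]
  · have h2 := hd _ h
    simp only [dotProduct, Matrix.mulVec, Fin.sum_univ_two, Matrix.cons_val_zero,
      Matrix.cons_val_one] at h2
    linarith

/-- A nonzero kernel vector would make the quadratic form vanish. -/
lemma IsPositiveDefinite.isUnit_det {d : Matrix (Fin 2) (Fin 2) ℝ} (hd : IsPositiveDefinite d) :
    IsUnit d.det := by
  rw [isUnit_iff_ne_zero]
  intro h
  obtain ⟨v, hv, h0⟩ := Matrix.exists_mulVec_eq_zero_iff.2 h
  have h1 := hd v hv
  rw [h0] at h1
  simp at h1

/-- `e^{-τ d} z`. -/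
def matrixFlow (d : Matrix (Fin 2) (Fin 2) ℝ) (τ : ℝ) (z : Fin 2 → ℂ) : Fin 2 → ℂ :=
  complexAction (NormedSpace.exp (-τ • d)) z

lemma matrixFlow_zero (d : Matrix (Fin 2) (Fin 2) ℝ) (z : Fin 2 → ℂ) : matrixFlow d 0 z = z := by
  simp [matrixFlow, NormedSpace.exp_zero, complexAction_one]

lemma matrixFlow_add (d : Matrix (Fin 2) (Fin 2) ℝ) (a b : ℝ) (z : Fin 2 → ℂ) :
    matrixFlow d (a + b) z = matrixFlow d a (matrixFlow d b z) := by
  rw [matrixFlow, matrixFlow, matrixFlow, ← complexAction_mul, ← Matrix.exp_add_of_commute,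
    neg_add, add_smul]
  exact ((Commute.refl d).smul_left _).smul_right _

section

-- Differentiating the exponential requires some normed algebra structure on matrices. The choice is
-- immaterial, since the exponential depends only on the topology.
attribute [local instance] Matrix.linftyOpNormedRing Matrix.linftyOpNormedAlgebra

lemma hasDerivAt_exp_neg_smul (d : Matrix (Fin 2) (Fin 2) ℝ) (τ : ℝ) :
    HasDerivAt (fun τ : ℝ => NormedSpace.exp (-τ • d)) (-(d * NormedSpace.exp (-τ • d))) τ := by
  have h := hasDerivAt_exp_smul_const' (𝕂 := ℝ) (-d) τ
  simp only [smul_neg, neg_mul] at h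
  simp only [neg_smul]
  exact h

lemma exp_neg_smul_continuous (d : Matrix (Fin 2) (Fin 2) ℝ) :
    Continuous fun τ : ℝ => NormedSpace.exp (-τ • d) :=
  NormedSpace.exp_continuous.comp (continuous_neg.smul continuous_const)

lemma hasDerivAt_matrixFlow (d : Matrix (Fin 2) (Fin 2) ℝ) (τ : ℝ) (z : Fin 2 → ℂ) :
    HasDerivAt (fun τ => matrixFlow d τ z) (-complexAction d (matrixFlow d τ z)) τ := by
  let ℓ : Matrix (Fin 2) (Fin 2) ℝ →ₗ[ℝ] (Fin 2 → ℂ) :=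
    { toFun := fun m => complexAction m z
      map_add' := fun a b => by
        ext i
        fin_cases i <;> simp [complexAction_zero_apply, complexAction_one_apply] <;> ring
      map_smul' := fun c a => by
        ext i
        fin_cases i <;> simp [complexAction_zero_apply, complexAction_one_apply] <;> ring }
  -- For fixed `z` the flow is a linear image of the matrix exponential, so its derivative is the
  -- image of the derivative.
  have h := ℓ.toContinuousLinearMap.hasFDerivAt.comp_hasDerivAt τ (hasDerivAt_exp_neg_smul d τ)
  have e : ℓ.toContinuousLinearMap (-(d * NormedSpace.exp (-τ • d))) =
      -complexAction d (matrixFlow d τ z) := by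
    rw [map_neg]
    exact congrArg Neg.neg (complexAction_mul _ _ _)
  exact e ▸ h

end

lemma matrixFlow_continuous (d : Matrix (Fin 2) (Fin 2) ℝ) (z : Fin 2 → ℂ) :
    Continuous fun τ => matrixFlow d τ z :=
  continuous_iff_continuousAt.2 fun τ => (hasDerivAt_matrixFlow d τ z).continuousAt

lemma hasDerivAt_norm_sq {f : ℝ → ℂ} {f' : ℂ} {t : ℝ} (h : HasDerivAt f f' t) :
    HasDerivAt (fun t => ‖f t‖ ^ 2) (2 * ((f t).re * f'.re + (f t).im * f'.im)) t := by
  have hr : HasDerivAt (fun t => (f t).re) f'.re t :=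
    Complex.reCLM.hasFDerivAt.comp_hasDerivAt t h
  have hi : HasDerivAt (fun t => (f t).im) f'.im t :=
    Complex.imCLM.hasFDerivAt.comp_hasDerivAt t h
  have h2 := (hr.pow 2).add (hi.pow 2)
  have e : (fun t => ‖f t‖ ^ 2) = fun t => (f t).re ^ 2 + (f t).im ^ 2 := by
    ext t
    rw [Complex.sq_norm, Complex.normSq_apply]
    ring
  rw [e]
  refine h2.congr_deriv ?_
  push_cast
  ring

/-- `e^{-τ d}` is a contraction if `d` is positive definite. -/
lemma IsPositiveDefinite.hermitianSq_matrixFlow_le {d : Matrix (Fin 2) (Fin 2) ℝ}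
    (hd : IsPositiveDefinite d) {τ : ℝ} (hτ : 0 ≤ τ) (z : Fin 2 → ℂ) :
    hermitianSq (matrixFlow d τ z) ≤ hermitianSq z := by
  have hder := fun τ => hasDerivAt_pi.1 (hasDerivAt_matrixFlow d τ z)
  have hd2 := fun τ => (hasDerivAt_norm_sq (hder τ 0)).add (hasDerivAt_norm_sq (hder τ 1))
  have hanti : Antitone fun τ => hermitianSq (matrixFlow d τ z) := by
    refine antitone_of_hasDerivAt_nonpos hd2 fun τ => ?_
    -- Because `d` is real, the derivative of the squared norm is `-2` times the sum of the
    -- quadratic forms at the real and at the imaginary part.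
    have h1 := hd.nonneg (matrixFlow d τ z 0).re (matrixFlow d τ z 1).re
    have h2 := hd.nonneg (matrixFlow d τ z 0).im (matrixFlow d τ z 1).im
    simp only [Pi.neg_apply, complexAction_zero_apply, complexAction_one_apply, Complex.neg_re,
      Complex.neg_im, Complex.add_re, Complex.add_im, Complex.re_ofReal_mul, Complex.im_ofReal_mul,
      Pi.zero_apply]
    linarith
  have h := hanti hτ
  simpa only [matrixFlow_zero] using h

/-- Mean value inequality: by contraction, the velocity `-d e^{-τ d} z` is bounded by a multiple of
`|z|` uniformly in `τ ≥ 0`. With `τ = h |ξ|^p`, division by `h` gives a bound on the difference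
quotients independent of `h`. -/
lemma IsPositiveDefinite.exists_hermitianSq_matrixFlow_sub_le {d : Matrix (Fin 2) (Fin 2) ℝ}
    (hd : IsPositiveDefinite d) :
    ∃ C, 0 < C ∧ ∀ τ, 0 ≤ τ → ∀ z,
      hermitianSq (matrixFlow d τ z - z) ≤ C * τ ^ 2 * hermitianSq z := by
  refine ⟨2 * ‖complexAction d‖ ^ 2 + 1, by positivity, fun τ hτ z => ?_⟩
  have hb : ∀ t ∈ Set.Ici (0 : ℝ), ‖-complexAction d (matrixFlow d t z)‖ ≤
      ‖complexAction d‖ * √(hermitianSq z) := by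
    intro t ht
    rw [norm_neg]
    refine ((complexAction d).le_opNorm _).trans ?_
    gcongr
    exact Real.le_sqrt_of_sq_le
      ((norm_sq_le_hermitianSq _).trans (hd.hermitianSq_matrixFlow_le ht z))
  have h := Convex.norm_image_sub_le_of_norm_hasDerivWithin_le
    (fun t _ => (hasDerivAt_matrixFlow d t z).hasDerivWithinAt) hb (convex_Ici (0 : ℝ))
    (Set.self_mem_Ici) (Set.mem_Ici.2 hτ)
  rw [matrixFlow_zero, sub_zero, Real.norm_of_nonneg hτ] at h
  calc hermitianSq (matrixFlow d τ z - z) ≤ 2 * ‖matrixFlow d τ z - z‖ ^ 2 :=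
        hermitianSq_le_norm_sq _
    _ ≤ 2 * (‖complexAction d‖ * √(hermitianSq z) * τ) ^ 2 := by gcongr
    _ = 2 * ‖complexAction d‖ ^ 2 * τ ^ 2 * hermitianSq z := by
        rw [mul_pow, mul_pow, Real.sq_sqrt (hermitianSq_nonneg z)]
        ring
    _ ≤ _ := by nlinarith [mul_nonneg (sq_nonneg τ) (hermitianSq_nonneg z)]

lemma IsPositiveDefinite.exists_hermitianSq_le {d : Matrix (Fin 2) (Fin 2) ℝ}
    (hd : IsPositiveDefinite d) :
    ∃ C, 0 < C ∧ ∀ z, hermitianSq z ≤ C * hermitianSq (complexAction d z) := by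
  obtain ⟨C, hC, h⟩ := exists_hermitianSq_complexAction_le d⁻¹
  refine ⟨C, hC, fun z => ?_⟩
  have h1 := h (complexAction d z)
  rwa [← complexAction_mul, Matrix.nonsing_inv_mul _ hd.isUnit_det, complexAction_one] at h1

/-- Conjugation commutes with real matrices. -/
lemma complexAction_conj (d : Matrix (Fin 2) (Fin 2) ℝ) (z : Fin 2 → ℂ) (i : Fin 2) :
    conj (complexAction d z i) = complexAction d (fun j => conj (z j)) i := by
  fin_cases i
  · simp [complexAction_zero_apply]
  · simp [complexAction_one_apply]

/-- The difference quotients of the flow at time `0`. -/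
lemma tendsto_matrixFlow_slope (d : Matrix (Fin 2) (Fin 2) ℝ) (σ : ℝ) (z : Fin 2 → ℂ) :
    Tendsto (fun h : ℝ => h⁻¹ • (matrixFlow d (h * σ) z - z)) (𝓝[>] 0)
      (𝓝 (-(σ • complexAction d z))) := by
  have h1 : HasDerivAt (fun h : ℝ => matrixFlow d (h * σ) z)
      (σ • -complexAction d (matrixFlow d (0 * σ) z)) 0 :=
    HasDerivAt.scomp (h := fun h : ℝ => h * σ) (0 : ℝ) (hasDerivAt_matrixFlow d (0 * σ) z)
      (by simpa using (hasDerivAt_id (0 : ℝ)).mul_const σ)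
  have h2 := (hasDerivAt_iff_tendsto_slope_zero.1 h1).mono_left (nhdsGT_le_nhdsNE 0)
  simpa only [zero_add, zero_mul, matrixFlow_zero, smul_neg] using h2

/-- Joint continuity makes the flow measurable in `ξ`, where both the time and the vector depend on
`ξ`. -/
lemma matrixFlow_continuous_uncurry (d : Matrix (Fin 2) (Fin 2) ℝ) :
    Continuous fun q : ℝ × (Fin 2 → ℂ) => matrixFlow d q.1 q.2 := by
  change Continuous fun q : ℝ × (Fin 2 → ℂ) =>
    (NormedSpace.exp (-q.1 • d)).map Complex.ofReal *ᵥ q.2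
  exact (((exp_neg_smul_continuous d).comp continuous_fst).matrix_map
    Complex.continuous_ofReal).matrix_mulVec continuous_snd

lemma aestronglyMeasurable_comp₂ {Φ : ℝ → (Fin 2 → ℂ) → Fin 2 → ℂ} {τ : Plane → ℝ}
    {G : Plane → Fin 2 → ℂ} (hΦ : Continuous fun q : ℝ × (Fin 2 → ℂ) => Φ q.1 q.2)
    (hτ : AEStronglyMeasurable τ volume) (hG : AEStronglyMeasurable G volume) :
    AEStronglyMeasurable (fun ξ => Φ (τ ξ) (G ξ)) volume :=
  hΦ.comp_aestronglyMeasurable (hτ.prodMk hG)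

/-! ### Bounds for the symbol and the Sobolev weight. -/

lemma fracSymbol_continuous {p : ℝ} (hp : 0 < p) : Continuous (fracSymbol p) := by
  unfold fracSymbol
  exact Continuous.rpow_const (by fun_prop) fun _ => Or.inr hp.le

lemma fracSymbol_neg (p : ℝ) (ξ : Plane) : fracSymbol p (-ξ) = fracSymbol p ξ := by
  simp [fracSymbol]

/-- A converse to `sobolevWeight_mul_fracSymbol_le`: control of `Û` and of `|ξ|^p Û` in order `s -
p` gives control of `Û` in order `s`. With `x = |ξ|`, it rests on `(1 + x²)^p ≤ (2 max(1, x²))^p ≤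
2^p (1 + x^{2p})`. -/
lemma exists_sobolevWeight_sq_le {p : ℝ} (hp : 0 < p) (s : ℝ) :
    ∃ C, 0 < C ∧ ∀ ξ, sobolevWeight s ξ ^ 2 ≤
      C * (sobolevWeight (s - p) ξ ^ 2 * (1 + fracSymbol p ξ ^ 2)) := by
  refine ⟨2 ^ p, by positivity, fun ξ => ?_⟩
  set x : ℝ := 2 * Real.pi * ‖ξ‖ with hx
  have hx0 : 0 ≤ x := by positivity
  have hw : ∀ r : ℝ, sobolevWeight r ξ ^ 2 = (1 + x ^ 2) ^ r := by
    intro r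
    rw [sobolevWeight, ← Real.rpow_natCast, ← Real.rpow_mul (by positivity)]
    congr 1
    push_cast
    ring
  have hσ : fracSymbol p ξ ^ 2 = (x ^ 2) ^ p := by
    rw [fracSymbol, ← Real.rpow_natCast, ← Real.rpow_mul hx0, ← Real.rpow_natCast,
      ← Real.rpow_mul hx0, mul_comm]
  have hb : (1 + x ^ 2) ^ p ≤ 2 ^ p * (1 + (x ^ 2) ^ p) := by
    rcases le_total (x ^ 2) 1 with h | h
    · have h1 : (1 + x ^ 2) ^ p ≤ 2 ^ p :=
        Real.rpow_le_rpow (by positivity) (by linarith) hp.le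
      have h2 : 0 ≤ (2 : ℝ) ^ p * (x ^ 2) ^ p := by positivity
      linarith
    · have h1 : (1 + x ^ 2) ^ p ≤ (2 * x ^ 2) ^ p :=
        Real.rpow_le_rpow (by positivity) (by linarith) hp.le
      rw [Real.mul_rpow (by norm_num) (by positivity)] at h1
      have h2 : 0 ≤ (2 : ℝ) ^ p := by positivity
      linarith
  have e : (1 + x ^ 2) ^ s = (1 + x ^ 2) ^ (s - p) * (1 + x ^ 2) ^ p := by
    rw [← Real.rpow_add (by positivity)]
    congr 1
    ring
  rw [hw, hw, hσ, e]
  calc (1 + x ^ 2) ^ (s - p) * (1 + x ^ 2) ^ p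
      ≤ (1 + x ^ 2) ^ (s - p) * (2 ^ p * (1 + (x ^ 2) ^ p)) := by gcongr
    _ = _ := by ring

/-! ### Fourier transforms of Sobolev functions -/

lemma Sobolev.exists_fourier {r : ℝ} {g : Plane → ℂ}
    (hg : MemLp (fun ξ => (sobolevWeight r ξ : ℂ) * g ξ) 2 volume)
    (hh : (fun ξ => conj (g (-ξ))) =ᵐ[volume] g) :
    ∃ u : Sobolev r, u.fourier =ᵐ[volume] g := by
  obtain ⟨v, hv⟩ := exists_isFourierTransform hg
  let u : Sobolev r := ⟨v, hv.isReal hh, g, hv, hg⟩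
  exact ⟨u, u.isFourierTransform.ae_eq hv⟩

lemma Sobolev.norm_sq_eq {r : ℝ} (u : Sobolev r) :
    ‖u‖ ^ 2 = ∫ ξ, sobolevWeight r ξ ^ 2 * ‖u.fourier ξ‖ ^ 2 := by
  change ‖u.memLp.toLp _‖ ^ 2 = _
  rw [← real_inner_self_eq_norm_sq, L2.inner_def]
  refine integral_congr_ae ?_
  filter_upwards [u.memLp.coeFn_toLp] with ξ hξ
  rw [hξ, real_inner_self_eq_norm_sq, norm_mul, mul_pow, Complex.norm_real, Real.norm_eq_abs,
    sq_abs]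

lemma Sobolev.integrable_sq {r : ℝ} (u : Sobolev r) :
    Integrable fun ξ => sobolevWeight r ξ ^ 2 * ‖u.fourier ξ‖ ^ 2 := by
  refine ((memLp_two_iff_integrable_sq_norm u.memLp.1).1 u.memLp).congr
    (Eventually.of_forall fun ξ => ?_)
  simp only [norm_mul, mul_pow, Complex.norm_real, Real.norm_eq_abs, sq_abs]

/-! ### Pairs as `ℂ²`-valued functions of the frequency. -/

namespace SobolevPair

variable {r : ℝ}

lemma fourier_aestronglyMeasurable (U : SobolevPair r) :
    AEStronglyMeasurable (SobolevPair.fourier U) volume := by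
  refine AEMeasurable.aestronglyMeasurable (aemeasurable_pi_iff.2 fun i => ?_)
  fin_cases i
  · exact U.fst.isFourierTransform.1.aestronglyMeasurable.aemeasurable
  · exact U.snd.isFourierTransform.1.aestronglyMeasurable.aemeasurable

/-- `SobolevPair.fourier` is a chosen representative, so the norm formula is stated for any function
equal to it almost everywhere; explicit formulas for the symbol can then be inserted directly. -/
lemma integrable_and_norm_sq_eq {U : SobolevPair r} {G : Plane → Fin 2 → ℂ}
    (h : SobolevPair.fourier U =ᵐ[volume] G) :
    Integrable (fun ξ => sobolevWeight r ξ ^ 2 * hermitianSq (G ξ)) ∧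
      ‖U‖ ^ 2 = ∫ ξ, sobolevWeight r ξ ^ 2 * hermitianSq (G ξ) := by
  have e : (fun ξ => sobolevWeight r ξ ^ 2 * ‖U.fst.fourier ξ‖ ^ 2 +
      sobolevWeight r ξ ^ 2 * ‖U.snd.fourier ξ‖ ^ 2) =ᵐ[volume]
      fun ξ => sobolevWeight r ξ ^ 2 * hermitianSq (G ξ) := by
    filter_upwards [h] with ξ hξ
    rw [← hξ, ← mul_add]
    rfl
  refine ⟨(U.fst.integrable_sq.add U.snd.integrable_sq).congr e, ?_⟩
  rw [WithLp.prod_norm_sq_eq_of_L2, Sobolev.norm_sq_eq, Sobolev.norm_sq_eq, ← integral_congr_ae e,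
    integral_add U.fst.integrable_sq U.snd.integrable_sq]

lemma fourier_hermitian (U : SobolevPair r) :
    ∀ᵐ ξ, ∀ i, conj (SobolevPair.fourier U (-ξ) i) = SobolevPair.fourier U ξ i := by
  filter_upwards [U.fst.isFourierTransform.hermitian U.fst.toDistribution_mem.1,
    U.snd.isFourierTransform.hermitian U.snd.toDistribution_mem.1] with ξ h0 h1 i
  fin_cases i
  · exact h0
  · exact h1

lemma memLp_of_integrable {G : Plane → Fin 2 → ℂ} (hm : AEStronglyMeasurable G volume)
    (hG : Integrable fun ξ => sobolevWeight r ξ ^ 2 * hermitianSq (G ξ)) (i : Fin 2) :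
    MemLp (fun ξ => (sobolevWeight r ξ : ℂ) * G ξ i) 2 volume := by
  have hmi : AEStronglyMeasurable (fun ξ => (sobolevWeight r ξ : ℂ) * G ξ i) volume :=
    (Complex.continuous_ofReal.comp (sobolevWeight_continuous r)).aestronglyMeasurable.mul
      ((continuous_apply i).comp_aestronglyMeasurable hm)
  refine (memLp_two_iff_integrable_sq_norm hmi).2 (hG.mono (hmi.norm.pow 2)
    (Eventually.of_forall fun ξ => ?_))
  rw [Real.norm_of_nonneg (by positivity),
    Real.norm_of_nonneg (mul_nonneg (by positivity) (hermitianSq_nonneg _)), norm_mul, mul_pow,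
    Complex.norm_real, Real.norm_eq_abs, sq_abs]
  gcongr
  fin_cases i <;> simp [hermitianSq]

lemma exists_fourier {G : Plane → Fin 2 → ℂ} (hm : AEStronglyMeasurable G volume)
    (hG : Integrable fun ξ => sobolevWeight r ξ ^ 2 * hermitianSq (G ξ))
    (hh : ∀ᵐ ξ, ∀ i, conj (G (-ξ) i) = G ξ i) :
    ∃ U : SobolevPair r, SobolevPair.fourier U =ᵐ[volume] G := by
  obtain ⟨u, hu⟩ := Sobolev.exists_fourier (memLp_of_integrable hm hG 0)
    (hh.mono fun ξ h => h 0)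
  obtain ⟨v, hv⟩ := Sobolev.exists_fourier (memLp_of_integrable hm hG 1)
    (hh.mono fun ξ h => h 1)
  refine ⟨WithLp.toLp 2 (u, v), ?_⟩
  filter_upwards [hu, hv] with ξ h0 h1
  ext i
  fin_cases i
  · exact h0
  · exact h1

lemma eq_of_fourier {U V : SobolevPair r}
    (h : SobolevPair.fourier U =ᵐ[volume] SobolevPair.fourier V) : U = V := by
  have h0 : U.fst = V.fst := Sobolev.eq_of_fourier (h.mono fun ξ hξ => congrFun hξ 0)
  have h1 : U.snd = V.snd := Sobolev.eq_of_fourier (h.mono fun ξ hξ => congrFun hξ 1)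
  exact (WithLp.ext_iff 2).2 (Prod.ext h0 h1)

lemma fourier_add (U V : SobolevPair r) :
    ∀ᵐ ξ, SobolevPair.fourier (U + V) ξ = SobolevPair.fourier U ξ + SobolevPair.fourier V ξ := by
  filter_upwards [Sobolev.fourier_add U.fst V.fst, Sobolev.fourier_add U.snd V.snd] with ξ h0 h1
  ext i
  fin_cases i
  · exact h0
  · exact h1

lemma fourier_smul (c : ℝ) (U : SobolevPair r) :
    ∀ᵐ ξ, SobolevPair.fourier (c • U) ξ = c • SobolevPair.fourier U ξ := by
  filter_upwards [Sobolev.fourier_smul c U.fst, Sobolev.fourier_smul c U.snd] with ξ h0 h1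
  ext i
  fin_cases i
  · exact h0
  · exact h1

lemma fourier_sub (U V : SobolevPair r) :
    ∀ᵐ ξ, SobolevPair.fourier (U - V) ξ = SobolevPair.fourier U ξ - SobolevPair.fourier V ξ := by
  have e : U - V = U + (-1 : ℝ) • V := by rw [neg_one_smul, sub_eq_add_neg]
  filter_upwards [fourier_add U ((-1 : ℝ) • V), fourier_smul (-1) V] with ξ h0 h1
  rw [e, h0, h1, neg_one_smul, sub_eq_add_neg]

end SobolevPair

/-! ### The domain and the symbol of the cross-diffusion operator -/

/-- Fourier transforms of a distribution agree almost everywhere, so the representative chosen in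
`H^r` also decides membership in `H^s`. -/
lemma mem_pairDomain_iff {s r : ℝ} (U : SobolevPair r) :
    U ∈ pairDomain s r ↔
      Integrable fun ξ => sobolevWeight s ξ ^ 2 * hermitianSq (SobolevPair.fourier U ξ) := by
  constructor
  · intro hU
    have h0 := (pairFst (⟨U, hU⟩ : pairDomain s r)).isFourierTransform.ae_eq
      U.fst.isFourierTransform
    have h1 := (pairSnd (⟨U, hU⟩ : pairDomain s r)).isFourierTransform.ae_eq
      U.snd.isFourierTransform
    have h : SobolevPair.fourier (WithLp.toLp 2 (pairFst (⟨U, hU⟩ : pairDomain s r),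
        pairSnd (⟨U, hU⟩ : pairDomain s r)) : SobolevPair s) =ᵐ[volume]
        SobolevPair.fourier U := by
      filter_upwards [h0, h1] with ξ h0 h1
      ext i
      fin_cases i
      · exact h0
      · exact h1
    exact (SobolevPair.integrable_and_norm_sq_eq h).1
  · intro h
    have hm := SobolevPair.memLp_of_integrable (SobolevPair.fourier_aestronglyMeasurable U) h
    exact ⟨⟨U.fst.toDistribution_mem.1, _, U.fst.isFourierTransform, hm 0⟩,
      ⟨U.snd.toDistribution_mem.1, _, U.snd.isFourierTransform, hm 1⟩⟩

lemma fourier_crossDiffusion {p : ℝ} (hp : 0 < p) (d : Matrix (Fin 2) (Fin 2) ℝ) (s : ℝ)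
    (U : (crossDiffusion hp d s).domain) :
    ∀ᵐ ξ, SobolevPair.fourier (crossDiffusion hp d s U) ξ =
      -(fracSymbol p ξ • complexAction d (SobolevPair.fourier U.1 ξ)) := by
  have hcomb : ∀ (a b : ℝ) (u v : Sobolev (s - p)),
      (-(a • u + b • v)).fourier =ᵐ[volume] fun ξ => -(a * u.fourier ξ + b * v.fourier ξ) := by
    intro a b u v
    rw [← neg_one_smul ℝ]
    filter_upwards [Sobolev.fourier_smul (-1) (a • u + b • v),
      Sobolev.fourier_add (a • u) (b • v), Sobolev.fourier_smul a u,
      Sobolev.fourier_smul b v] with ξ h1 h2 h3 h4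
    rw [h1, Pi.smul_apply, h2, Pi.add_apply, h3, h4]
    simp only [Pi.smul_apply, Complex.real_smul, neg_one_smul]
  have h0 : (pairFst U).fourier =ᵐ[volume] U.1.fst.fourier :=
    (pairFst U).isFourierTransform.ae_eq U.1.fst.isFourierTransform
  have h1 : (pairSnd U).fourier =ᵐ[volume] U.1.snd.fourier :=
    (pairSnd U).isFourierTransform.ae_eq U.1.snd.isFourierTransform
  filter_upwards [h0, h1, fourier_fracLaplacian hp (pairFst U),
    fourier_fracLaplacian hp (pairSnd U),
    hcomb (d 0 0) (d 0 1) (fracLaplacian hp (pairFst U)) (fracLaplacian hp (pairSnd U)),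
    hcomb (d 1 0) (d 1 1) (fracLaplacian hp (pairFst U)) (fracLaplacian hp (pairSnd U))]
    with ξ h0 h1 h2 h3 h4 h5
  rw [h2, h3, h0, h1] at h4 h5
  ext i
  fin_cases i
  · refine h4.trans ?_
    simp only [Fin.zero_eta, Pi.neg_apply, Pi.smul_apply, complexAction_zero_apply,
      Complex.real_smul, SobolevPair.fourier, Matrix.cons_val_zero, Matrix.cons_val_one]
    ring
  · refine h5.trans ?_
    simp only [Fin.mk_one, Pi.neg_apply, Pi.smul_apply, complexAction_one_apply,
      Complex.real_smul, SobolevPair.fourier, Matrix.cons_val_zero, Matrix.cons_val_one]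
    ring

/-- No domain condition appears on the right: the identity, with `V` in the space of order `s - p`,
already forces `U` into `H^s × H^s`. This is elliptic regularity, from the invertibility of `d`. -/
lemma mem_crossDiffusion_graph_iff {p : ℝ} (hp : 0 < p) {d : Matrix (Fin 2) (Fin 2) ℝ}
    (hd : IsPositiveDefinite d) (s : ℝ) (U V : SobolevPair (s - p)) :
    (U, V) ∈ (crossDiffusion hp d s).graph ↔ ∀ᵐ ξ, SobolevPair.fourier V ξ =
      -(fracSymbol p ξ • complexAction d (SobolevPair.fourier U ξ)) := by
  rw [LinearPMap.mem_graph_iff]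
  constructor
  · rintro ⟨W, hW, rfl⟩
    have hW' : W.1 = U := hW
    exact hW' ▸ fourier_crossDiffusion hp d s W
  · intro h
    have hU : U ∈ pairDomain s (s - p) := by
      rw [mem_pairDomain_iff]
      obtain ⟨C, hC, hb⟩ := exists_sobolevWeight_sq_le hp s
      obtain ⟨B, hB, hdb⟩ := hd.exists_hermitianSq_le
      have h1 := (SobolevPair.integrable_and_norm_sq_eq (U := U) EventuallyEq.rfl).1
      have h2 := (SobolevPair.integrable_and_norm_sq_eq (U := V) EventuallyEq.rfl).1
      -- In the factor `1 + |ξ|^{2p}`, the `1` is paid for by `U` and the `|ξ|^{2p}` by `V`, through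
      -- the bound `B` for the inverse of `d`.
      refine ((h1.const_mul C).add (h2.const_mul (C * B))).mono' ?_ ?_
      · exact ((sobolevWeight_continuous s).pow 2).aestronglyMeasurable.mul
          (hermitianSq_continuous.comp_aestronglyMeasurable
            (SobolevPair.fourier_aestronglyMeasurable U))
      · filter_upwards [h] with ξ hξ
        rw [Real.norm_of_nonneg (mul_nonneg (by positivity) (hermitianSq_nonneg _)), Pi.add_apply,
          hξ, ← neg_smul, hermitianSq_smul]
        set z := SobolevPair.fourier U ξ
        set σ := fracSymbol p ξ
        set w := sobolevWeight (s - p) ξ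
        calc sobolevWeight s ξ ^ 2 * hermitianSq z
            ≤ C * (w ^ 2 * (1 + σ ^ 2)) * hermitianSq z :=
              mul_le_mul_of_nonneg_right (hb ξ) (hermitianSq_nonneg z)
          _ = C * (w ^ 2 * hermitianSq z) + C * w ^ 2 * σ ^ 2 * hermitianSq z := by ring
          _ ≤ C * (w ^ 2 * hermitianSq z) +
              C * w ^ 2 * σ ^ 2 * (B * hermitianSq (complexAction d z)) := by
              gcongr
              exact hdb z
          _ = _ := by ring
    refine ⟨⟨U, hU⟩, rfl, SobolevPair.eq_of_fourier ?_⟩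
    filter_upwards [h, fourier_crossDiffusion hp d s ⟨U, hU⟩] with ξ h1 h2
    rw [h1, h2]

/-! ### The semigroup -/

section

variable {p : ℝ} {d : Matrix (Fin 2) (Fin 2) ℝ} {r : ℝ}

/-- The flow contracts only forward in time; `max t 0` makes the operator bounded for all real `t`
and changes nothing for `t ≥ 0`. -/
lemma exists_fourier_matrixFlow (hp : 0 < p) (hd : IsPositiveDefinite d) (t : ℝ)
    (U : SobolevPair r) :
    ∃ V : SobolevPair r, SobolevPair.fourier V =ᵐ[volume]
      fun ξ => matrixFlow d (max t 0 * fracSymbol p ξ) (SobolevPair.fourier U ξ) := by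
  have hm : AEStronglyMeasurable (fun ξ =>
      matrixFlow d (max t 0 * fracSymbol p ξ) (SobolevPair.fourier U ξ)) volume :=
    aestronglyMeasurable_comp₂ (matrixFlow_continuous_uncurry d)
      (continuous_const.mul (fracSymbol_continuous hp)).aestronglyMeasurable
      (SobolevPair.fourier_aestronglyMeasurable U)
  refine SobolevPair.exists_fourier hm ?_ ?_
  · refine (SobolevPair.integrable_and_norm_sq_eq (U := U) EventuallyEq.rfl).1.mono' ?_
      (Eventually.of_forall fun ξ => ?_)
    · exact ((sobolevWeight_continuous r).pow 2).aestronglyMeasurable.mul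
        (hermitianSq_continuous.comp_aestronglyMeasurable hm)
    · rw [Real.norm_of_nonneg (mul_nonneg (by positivity) (hermitianSq_nonneg _))]
      gcongr
      exact hd.hermitianSq_matrixFlow_le
        (mul_nonneg (le_max_right _ _) (fracSymbol_nonneg p ξ)) _
  -- Hermitian symmetry survives because the matrix is real and depends on `ξ` only through `|ξ|`.
  · filter_upwards [SobolevPair.fourier_hermitian U] with ξ hξ i
    rw [matrixFlow, complexAction_conj, fracSymbol_neg]
    simp only [hξ]
    rfl

/-- The operator with symbol `e^{-t |ξ|^p d}`, `t ≥ 0`. -/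
def crossDiffusionSemigroup (hp : 0 < p) (hd : IsPositiveDefinite d) (r t : ℝ) :
    SobolevPair r →L[ℝ] SobolevPair r :=
  LinearMap.mkContinuous
    { toFun := fun U => (exists_fourier_matrixFlow hp hd t U).choose
      map_add' := fun U V => SobolevPair.eq_of_fourier <| by
        filter_upwards [(exists_fourier_matrixFlow hp hd t (U + V)).choose_spec,
          (exists_fourier_matrixFlow hp hd t U).choose_spec,
          (exists_fourier_matrixFlow hp hd t V).choose_spec, SobolevPair.fourier_add U V,
          SobolevPair.fourier_add (exists_fourier_matrixFlow hp hd t U).choose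
            (exists_fourier_matrixFlow hp hd t V).choose] with ξ h1 h2 h3 h4 h5
        rw [h1, h5, h2, h3, h4]
        exact map_add (complexAction _) _ _
      map_smul' := fun c U => SobolevPair.eq_of_fourier <| by
        filter_upwards [(exists_fourier_matrixFlow hp hd t (c • U)).choose_spec,
          (exists_fourier_matrixFlow hp hd t U).choose_spec, SobolevPair.fourier_smul c U,
          SobolevPair.fourier_smul c (exists_fourier_matrixFlow hp hd t U).choose]
          with ξ h1 h2 h3 h4
        rw [RingHom.id_apply, h1, h4, h2, h3]
        exact map_smul (complexAction _) _ _ } 1 fun U => by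
    rw [one_mul]
    refine le_of_sq_le_sq ?_ (norm_nonneg U)
    obtain ⟨h1, e1⟩ := SobolevPair.integrable_and_norm_sq_eq
      (exists_fourier_matrixFlow hp hd t U).choose_spec
    obtain ⟨h2, e2⟩ := SobolevPair.integrable_and_norm_sq_eq (U := U) EventuallyEq.rfl
    refine e1.le.trans (le_trans (integral_mono h1 h2 fun ξ => ?_) e2.ge)
    dsimp only
    gcongr
    exact hd.hermitianSq_matrixFlow_le (mul_nonneg (le_max_right _ _) (fracSymbol_nonneg p ξ)) _

lemma norm_crossDiffusionSemigroup_le (hp : 0 < p) (hd : IsPositiveDefinite d) (r t : ℝ) :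
    ‖crossDiffusionSemigroup hp hd r t‖ ≤ 1 :=
  LinearMap.mkContinuous_norm_le _ zero_le_one _

lemma fourier_crossDiffusionSemigroup (hp : 0 < p) (hd : IsPositiveDefinite d) {t : ℝ}
    (ht : 0 ≤ t) (U : SobolevPair r) :
    ∀ᵐ ξ, SobolevPair.fourier (crossDiffusionSemigroup hp hd r t U) ξ =
      matrixFlow d (t * fracSymbol p ξ) (SobolevPair.fourier U ξ) := by
  have h : ∀ᵐ ξ, SobolevPair.fourier (crossDiffusionSemigroup hp hd r t U) ξ =
      matrixFlow d (max t 0 * fracSymbol p ξ) (SobolevPair.fourier U ξ) :=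
    (exists_fourier_matrixFlow hp hd t U).choose_spec
  rwa [max_eq_left ht] at h

lemma crossDiffusionSemigroup_zero (hp : 0 < p) (hd : IsPositiveDefinite d) (r : ℝ) :
    crossDiffusionSemigroup hp hd r 0 = ContinuousLinearMap.id ℝ _ := by
  ext1 U
  refine SobolevPair.eq_of_fourier ?_
  filter_upwards [fourier_crossDiffusionSemigroup hp hd le_rfl U] with ξ h
  rw [h, zero_mul, matrixFlow_zero, ContinuousLinearMap.id_apply]

lemma crossDiffusionSemigroup_add (hp : 0 < p) (hd : IsPositiveDefinite d) (r : ℝ) {a b : ℝ}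
    (ha : 0 ≤ a) (hb : 0 ≤ b) :
    crossDiffusionSemigroup hp hd r (a + b) =
      (crossDiffusionSemigroup hp hd r a).comp (crossDiffusionSemigroup hp hd r b) := by
  ext1 U
  refine SobolevPair.eq_of_fourier ?_
  filter_upwards [fourier_crossDiffusionSemigroup hp hd (add_nonneg ha hb) U,
    fourier_crossDiffusionSemigroup hp hd hb U,
    fourier_crossDiffusionSemigroup hp hd ha (crossDiffusionSemigroup hp hd r b U)]
    with ξ h1 h2 h3
  rw [ContinuousLinearMap.comp_apply, h1, h3, h2, add_mul, matrixFlow_add]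

/-! ### Norm convergence and pointwise convergence of Fourier transforms. -/

/-- A family in `H^r × H^r` converges to zero if its Fourier transforms converge pointwise and are
dominated. -/
lemma tendsto_zero_of_dominated {V : ℝ → SobolevPair r} {G : ℝ → Plane → Fin 2 → ℂ}
    {B : Plane → ℝ}
    (hV : ∀ h, 0 < h → SobolevPair.fourier (V h) =ᵐ[volume] G h)
    (hB : Integrable B)
    (hG : ∀ h, 0 < h → ∀ ξ, sobolevWeight r ξ ^ 2 * hermitianSq (G h ξ) ≤ B ξ)
    (hlim : ∀ ξ, Tendsto (fun h => G h ξ) (𝓝[>] 0) (𝓝 0)) :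
    Tendsto V (𝓝[>] 0) (𝓝 0) := by
  have h1 : Tendsto (fun h => ∫ ξ, sobolevWeight r ξ ^ 2 * hermitianSq (G h ξ)) (𝓝[>] 0)
      (𝓝 (∫ _ : Plane, (0 : ℝ))) := by
    refine tendsto_integral_filter_of_dominated_convergence B ?_ ?_ hB
      (Eventually.of_forall fun ξ => ?_)
    · filter_upwards [self_mem_nhdsWithin] with h hh
      exact (SobolevPair.integrable_and_norm_sq_eq (hV h hh)).1.aestronglyMeasurable
    · filter_upwards [self_mem_nhdsWithin] with h hh
      refine Eventually.of_forall fun ξ => ?_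
      rw [Real.norm_of_nonneg (mul_nonneg (by positivity) (hermitianSq_nonneg _))]
      exact hG h hh ξ
    · have h2 := ((hermitianSq_continuous.tendsto 0).comp (hlim ξ)).const_mul
        (sobolevWeight r ξ ^ 2)
      simpa [hermitianSq] using h2
  rw [integral_zero] at h1
  have h2 : Tendsto (fun h => ‖V h‖ ^ 2) (𝓝[>] 0) (𝓝 0) := by
    refine h1.congr' ?_
    filter_upwards [self_mem_nhdsWithin] with h hh
    exact (SobolevPair.integrable_and_norm_sq_eq (hV h hh)).2.symm
  rw [tendsto_zero_iff_norm_tendsto_zero]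
  have h3 := (Real.continuous_sqrt.tendsto 0).comp h2
  simpa [Function.comp_def, Real.sqrt_sq (norm_nonneg _)] using h3

/-- If a family converges to zero in `H^r × H^r` and its Fourier transforms converge pointwise, then
their limit is zero. -/
lemma ae_eq_zero_of_tendsto_zero {V : ℝ → SobolevPair r} {G : ℝ → Plane → Fin 2 → ℂ}
    {L : Plane → Fin 2 → ℂ}
    (hV : ∀ h, 0 < h → SobolevPair.fourier (V h) =ᵐ[volume] G h)
    (hlim : ∀ ξ, Tendsto (fun h => G h ξ) (𝓝[>] 0) (𝓝 (L ξ)))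
    (h0 : Tendsto V (𝓝[>] 0) (𝓝 0)) : ∀ᵐ ξ, L ξ = 0 := by
  -- Fatou's lemma is applied along the sequence `1 / (n + 1)`.
  let u : ℕ → ℝ := fun n => 1 / ((n : ℝ) + 1)
  have hu0 : ∀ n, 0 < u n := fun n => Nat.one_div_pos_of_nat
  have hu : Tendsto u atTop (𝓝[>] 0) :=
    tendsto_nhdsWithin_iff.2 ⟨tendsto_one_div_add_atTop_nhds_zero_nat, Eventually.of_forall hu0⟩
  let F : ℕ → Plane → ℝ := fun n ξ => sobolevWeight r ξ ^ 2 * hermitianSq (G (u n) ξ)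
  have hF0 : ∀ n ξ, 0 ≤ F n ξ := fun n ξ => mul_nonneg (by positivity) (hermitianSq_nonneg _)
  have hF := fun n => SobolevPair.integrable_and_norm_sq_eq (hV (u n) (hu0 n))
  have hm : ∀ n, AEMeasurable (fun ξ => ENNReal.ofReal (F n ξ)) volume := fun n =>
    (hF n).1.aestronglyMeasurable.aemeasurable.ennreal_ofReal
  have hpt : ∀ ξ, Tendsto (fun n => ENNReal.ofReal (F n ξ)) atTop
      (𝓝 (ENNReal.ofReal (sobolevWeight r ξ ^ 2 * hermitianSq (L ξ)))) := fun ξ =>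
    ENNReal.tendsto_ofReal
      (((hermitianSq_continuous.tendsto _).comp ((hlim ξ).comp hu)).const_mul _)
  have hint : Tendsto (fun n => ∫⁻ ξ, ENNReal.ofReal (F n ξ)) atTop (𝓝 0) := by
    have h1 := ((h0.comp hu).norm.pow 2)
    have h2 := ENNReal.tendsto_ofReal h1
    simp only [norm_zero, ne_eq, OfNat.ofNat_ne_zero, not_false_eq_true, zero_pow,
      ENNReal.ofReal_zero] at h2
    refine h2.congr fun n => ?_
    rw [Function.comp_apply, (hF n).2]
    exact ofReal_integral_eq_lintegral_ofReal (hF n).1 (Eventually.of_forall (hF0 n))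
  have hz : ∫⁻ ξ : Plane, ENNReal.ofReal (sobolevWeight r ξ ^ 2 * hermitianSq (L ξ)) = 0 := by
    -- Fatou: the integral of the pointwise limit is at most the limit of the squared norms, which
    -- is zero.
    have h1 := lintegral_liminf_le' (u := atTop) hm
    rw [hint.liminf_eq] at h1
    simp only [fun ξ => (hpt ξ).liminf_eq] at h1
    exact nonpos_iff_eq_zero.1 h1
  rw [lintegral_eq_zero_iff'
    (aemeasurable_of_tendsto_metrizable_ae (atTop : Filter ℕ) hm (Eventually.of_forall hpt))] at hz
  filter_upwards [hz] with ξ hξ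
  have h1 : sobolevWeight r ξ ^ 2 * hermitianSq (L ξ) ≤ 0 := ENNReal.ofReal_eq_zero.1 hξ
  have h2 : 0 < sobolevWeight r ξ ^ 2 := pow_pos (sobolevWeight_pos r ξ) 2
  refine hermitianSq_eq_zero (le_antisymm ?_ (hermitianSq_nonneg _))
  exact nonpos_of_mul_nonpos_right h1 h2

/-! ### Strong continuity and the generator. -/

lemma isC0Semigroup_crossDiffusionSemigroup (hp : 0 < p) (hd : IsPositiveDefinite d) (r : ℝ) :
    IsC0Semigroup (crossDiffusionSemigroup hp hd r) where
  map_zero := crossDiffusionSemigroup_zero hp hd r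
  map_add _ _ ha hb := crossDiffusionSemigroup_add hp hd r ha hb
  tendsto_zero U := by
    rw [← tendsto_sub_nhds_zero_iff]
    have hU := (SobolevPair.integrable_and_norm_sq_eq (U := U) EventuallyEq.rfl).1
    -- The constant is `4 = 2 + 2`: by `hermitianSq_add_le` and contraction, each of the two terms
    -- contributes at most twice the square of `Û`.
    refine tendsto_zero_of_dominated
      (G := fun h ξ => matrixFlow d (h * fracSymbol p ξ) (SobolevPair.fourier U ξ) -
        SobolevPair.fourier U ξ) (fun h hh => ?_) (hU.const_mul 4) (fun h hh ξ => ?_) fun ξ => ?_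
    · filter_upwards [fourier_crossDiffusionSemigroup hp hd hh.le U,
        SobolevPair.fourier_sub (crossDiffusionSemigroup hp hd r h U) U] with ξ h1 h2
      rw [h2, h1]
    · set z := SobolevPair.fourier U ξ
      have h1 := hd.hermitianSq_matrixFlow_le (mul_nonneg hh.le (fracSymbol_nonneg p ξ)) z
      have h2 := hermitianSq_add_le (matrixFlow d (h * fracSymbol p ξ) z) ((-1 : ℝ) • z)
      rw [hermitianSq_smul, neg_one_smul, ← sub_eq_add_neg] at h2
      calc sobolevWeight r ξ ^ 2 * hermitianSq (matrixFlow d (h * fracSymbol p ξ) z - z)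
          ≤ sobolevWeight r ξ ^ 2 * (4 * hermitianSq z) := by
            gcongr
            linarith
        _ = _ := by ring
    · have h1 : Continuous fun h : ℝ =>
          matrixFlow d (h * fracSymbol p ξ) (SobolevPair.fourier U ξ) :=
        (matrixFlow_continuous d _).comp (continuous_mul_const _)
      have h2 := (h1.tendsto 0).mono_left (nhdsWithin_le_nhds (s := Set.Ioi 0))
      rw [zero_mul, matrixFlow_zero] at h2
      exact tendsto_sub_nhds_zero_iff.2 h2

lemma isInfinitesimalGenerator_crossDiffusion (hp : 0 < p) (hd : IsPositiveDefinite d) (s : ℝ) :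
    IsInfinitesimalGenerator (crossDiffusion hp d s)
      (crossDiffusionSemigroup hp hd (s - p)) := by
  intro U V
  set Q : ℝ → Plane → Fin 2 → ℂ := fun h ξ =>
    h⁻¹ • (matrixFlow d (h * fracSymbol p ξ) (SobolevPair.fourier U ξ) -
      SobolevPair.fourier U ξ) with hQdef
  have hQ : ∀ h, 0 < h → ∀ᵐ ξ, SobolevPair.fourier
      (h⁻¹ • (crossDiffusionSemigroup hp hd (s - p) h U - U) - V) ξ =
      Q h ξ - SobolevPair.fourier V ξ := by
    intro h hh
    filter_upwards [fourier_crossDiffusionSemigroup hp hd hh.le U,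
      SobolevPair.fourier_sub (crossDiffusionSemigroup hp hd (s - p) h U) U,
      SobolevPair.fourier_smul h⁻¹ (crossDiffusionSemigroup hp hd (s - p) h U - U),
      SobolevPair.fourier_sub (h⁻¹ • (crossDiffusionSemigroup hp hd (s - p) h U - U)) V]
      with ξ h1 h2 h3 h4
    rw [h4, h3, h2, h1]
  have hlim : ∀ ξ, Tendsto (fun h => Q h ξ) (𝓝[>] 0)
      (𝓝 (-(fracSymbol p ξ • complexAction d (SobolevPair.fourier U ξ)))) := fun ξ =>
    tendsto_matrixFlow_slope d (fracSymbol p ξ) (SobolevPair.fourier U ξ)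
  rw [← tendsto_sub_nhds_zero_iff]
  constructor
  · intro hUV
    have hV := (mem_crossDiffusion_graph_iff hp hd s U V).1 hUV
    have hU : Integrable fun ξ => sobolevWeight s ξ ^ 2 * hermitianSq (SobolevPair.fourier U ξ) :=
      (mem_pairDomain_iff U).1 (LinearPMap.mem_domain_of_mem_graph hUV)
    obtain ⟨C, hC, hCb⟩ := hd.exists_hermitianSq_matrixFlow_sub_le
    obtain ⟨B, hB, hBb⟩ := exists_hermitianSq_complexAction_le d
    -- In the dominating function, `2 * C` accounts for the difference quotient and `2 * B` for its
    -- limit.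
    refine tendsto_zero_of_dominated
      (G := fun h ξ => Q h ξ + fracSymbol p ξ • complexAction d (SobolevPair.fourier U ξ))
      (fun h hh => ?_) (hU.const_mul (2 * C + 2 * B)) (fun h hh ξ => ?_) fun ξ => ?_
    · filter_upwards [hQ h hh, hV] with ξ h1 h2
      rw [h1, h2, sub_neg_eq_add]
    · set z := SobolevPair.fourier U ξ with hz
      set σ := fracSymbol p ξ
      have hw := sobolevWeight_mul_fracSymbol_le hp s ξ
      have hw0 : 0 ≤ sobolevWeight (s - p) ξ * σ :=
        mul_nonneg (sobolevWeight_pos _ ξ).le (fracSymbol_nonneg p ξ)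
      have h1 : hermitianSq (Q h ξ) ≤ C * σ ^ 2 * hermitianSq z := by
        have h2 := hCb (h * σ) (mul_nonneg hh.le (fracSymbol_nonneg p ξ)) z
        calc hermitianSq (Q h ξ) = h⁻¹ ^ 2 * hermitianSq (matrixFlow d (h * σ) z - z) :=
              hermitianSq_smul _ _
          _ ≤ h⁻¹ ^ 2 * (C * (h * σ) ^ 2 * hermitianSq z) := by gcongr
          _ = _ := by field_simp
      have h2 : hermitianSq (σ • complexAction d z) ≤ B * σ ^ 2 * hermitianSq z := by
        rw [hermitianSq_smul]
        calc σ ^ 2 * hermitianSq (complexAction d z) ≤ σ ^ 2 * (B * hermitianSq z) := by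
              gcongr
              exact hBb z
          _ = _ := by ring
      have h3 := hermitianSq_add_le (Q h ξ) (σ • complexAction d z)
      have h4 := hermitianSq_nonneg z
      calc sobolevWeight (s - p) ξ ^ 2 * hermitianSq (Q h ξ + σ • complexAction d z)
          ≤ sobolevWeight (s - p) ξ ^ 2 * ((2 * C + 2 * B) * σ ^ 2 * hermitianSq z) := by
            gcongr
            linarith
        -- The factor `|ξ|^p` is absorbed by raising the order of the weight from `s - p` to `s`,
        -- where `U` is integrable.
        _ = (sobolevWeight (s - p) ξ * σ) ^ 2 * ((2 * C + 2 * B) * hermitianSq z) := by ring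
        _ ≤ sobolevWeight s ξ ^ 2 * ((2 * C + 2 * B) * hermitianSq z) := by gcongr
        _ = _ := by ring
    · have h1 := (hlim ξ).add_const
        (fracSymbol p ξ • complexAction d (SobolevPair.fourier U ξ))
      rwa [neg_add_cancel] at h1
  · intro h
    rw [mem_crossDiffusion_graph_iff hp hd]
    -- The quotients minus `V` tend to zero in norm, while their transforms tend pointwise to
    -- `-|ξ|^p d Û - V̂`, which must therefore vanish almost everywhere.
    have h1 := ae_eq_zero_of_tendsto_zero hQ
      (fun ξ => (hlim ξ).sub_const (SobolevPair.fourier V ξ)) h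
    filter_upwards [h1] with ξ hξ
    exact (sub_eq_zero.1 hξ).symm

end

end

theorem theorem2 (p : ℝ) (hp : 0 < p) (d : Matrix (Fin 2) (Fin 2) ℝ) (hd : IsPositiveDefinite d)
    (s : ℝ) :
    ∃ K : ℝ → SobolevPair (s - p) →L[ℝ] SobolevPair (s - p),
      IsC0Semigroup K ∧
      IsInfinitesimalGenerator (crossDiffusion hp d s) K ∧
      (∀ t : ℝ, 0 ≤ t → ∀ U : SobolevPair (s - p), ∀ᵐ ξ : Plane,
        (K t U).fourier ξ = (crossDiffusionSymbol p d t ξ).map Complex.ofReal *ᵥ U.fourier ξ) ∧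
      (∃ M : ℝ, 0 < M ∧ ∀ t : ℝ, 0 ≤ t → ‖K t‖ ≤ M) ∧
      (IsReducedForm d → ∀ t : ℝ, 0 ≤ t → ‖K t‖ ≤ 1) :=
  ⟨crossDiffusionSemigroup hp hd (s - p), isC0Semigroup_crossDiffusionSemigroup hp hd (s - p),
    isInfinitesimalGenerator_crossDiffusion hp hd s,
    -- `matrixFlow d (t * fracSymbol p ξ)` unfolds to the action of `crossDiffusionSymbol p d t ξ`,
    -- so the two formulas agree by definition.
    fun _ ht U => fourier_crossDiffusionSemigroup hp hd ht U,
    ⟨1, one_pos, fun t _ => norm_crossDiffusionSemigroup_le hp hd (s - p) t⟩,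
    fun _ t _ => norm_crossDiffusionSemigroup_le hp hd (s - p) t⟩
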